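/- Let $1<p<2$. For $0<b\le 1$ let $$B_b^p:=\{x+iy\in\mathbb C:\ |x|^p+|y/b|^p\le 1\}.$$ The curvature of the boundary $\partial B_b^p$ at a point is $\kappa=d\alpha/ds\in[-\infty,\infty]$, the derivative of the tangent angle $\alpha$ with respect to arc length $s$ along the counterclockwise oriented boundary curve, the value $+\infty$ being allowed. For $K\subset\mathbb C$ compact and $n\ge 0$ let $$M_n(K):=\inf_q \frac{\|q'\|_K}{\|q\|_K},\qquad \|q\|_K:=\sup_{z\in K}|q(z)|,$$ where $q$ ranges over the complex polynomials of degree exactly $n$ all of whose zeros lie in $K$. (i) For every $0<b\le1$, the curvature of $\partial B_b^p$ exists at every boundary point, is infinite exactly at the four vertices $\pm1,\pm ib$ (and finite at all other points), and at every boundary point satisfies $$\kappa\ \ge\ (p-1)\,b\,2^{1/p-1/2}.$$ (ii) For every $0<b\le1$ and every integer $n\ge 0$, $$M_n(B_b^p)\ \ge\ (p-1)\,b\,2^{1/p-3/2}\,n.$$ (iii) For $b=1$, the minimum of the curvature over $\partial B_1^p$ is attained and equals exactly $(p-1)2^{1/p-1/2}$. -/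

import Mathlib

open Set Filter Topology

/-- The supremum norm over `K` of the values of a complex polynomial. -/
noncomputable def polyNorm (K : Set ℂ) (q : Polynomial ℂ) : ℝ :=
  sSup ((fun z => ‖q.eval z‖) '' K)

/-- Complex polynomials of degree exactly `n` all of whose roots lie in `K`. -/
def polysWithRootsIn (n : ℕ) (K : Set ℂ) : Set (Polynomial ℂ) :=
  {q | q.degree = (n : WithBot ℕ) ∧ ∀ z : ℂ, q.IsRoot z → z ∈ K}

/-- The inverse Markov factor: the infimum of `‖q'‖ / ‖q‖` (sup norms over `K`), over the
polynomials `q` of degree exactly `n` all of whose roots lie in `K`. -/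
noncomputable def inverseMarkovFactor (n : ℕ) (K : Set ℂ) : ℝ :=
  sInf ((fun q : Polynomial ℂ => polyNorm K (Polynomial.derivative q) / polyNorm K q) ''
    polysWithRootsIn n K)

/-- The boundary of the convex domain `K` has curvature `κ`, possibly infinite, at its point `z`:
`κ` is the derivative `dα/ds` at `z` of the tangent angle `α` with respect to arc length `s`.
Here `γ` is a regular `C¹` parametrization of the boundary near `z = γ 0`, traversed
counterclockwise (`K` lies to the left of each tangent line), `α t` is the argument of the
velocity, and the signed arc length from `γ 0` to `γ t` is the integral of the speed. -/
def HasBoundaryCurvatureAt (K : Set ℂ) (z : ℂ) (κ : EReal) : Prop :=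
  ∃ (r : ℝ) (γ : ℝ → ℂ) (α : ℝ → ℝ), 0 < r ∧ γ 0 = z ∧
    ContDiffOn ℝ 1 γ (Ioo (-r) r) ∧ ContinuousOn α (Ioo (-r) r) ∧
    (∀ t ∈ Ioo (-r) r,
      γ t ∈ frontier K ∧ deriv γ t ≠ 0 ∧
      deriv γ t = (‖deriv γ t‖ : ℂ) * Complex.exp ((α t : ℂ) * Complex.I) ∧
      ∀ w ∈ K, 0 ≤ ((starRingEnd ℂ) (deriv γ t) * (w - γ t)).im) ∧
    Tendsto (fun t : ℝ => (((α t - α 0) / ∫ u in (0 : ℝ)..t, ‖deriv γ u‖ : ℝ) : EReal))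
      (𝓝[≠] 0) (𝓝 κ)

/-- The `ℓ_p`-ellipse `{|x|^p + |y/b|^p ≤ 1}`, as a subset of the complex plane. -/
def lpEllipse (p b : ℝ) : Set ℂ :=
  {z | |z.re| ^ p + |z.im / b| ^ p ≤ 1}

/-!
Write `F z = |x| ^ p + |y / b| ^ p`, so that the boundary is `F = 1`, with outward normal
`g = lpNormal`, the gradient of `F` divided by `p`.

**Curvature.** Along any admissible parametrization `γ` the velocity is a positive multiple of
`I * g (γ t)` (`tangent_angle`), so the sine of the turning angle is the wedge product of the normals
at `γ 0` and `γ t`, over their lengths. Its derivative is finite away from the vertices; at a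
vertex it is infinite, as `|x| ^ (p - 2) * x` has infinite slope at `0` for `p < 2`
(`tendsto_wedge_lpNormal_div`). Thus the curvature, if it exists, is the explicit `lpCurvature`
(`tendsto_angle_div_arcLength`), and the parametrization by the argument shows that it exists. With
`v = y / b` it is `(p - 1) |x v| ^ (p - 2) / (b ^ 2 * ‖g‖ ^ 3)` off the vertices, and the lower
bound follows from the power mean inequality and the inequality of the arithmetic and the geometric
mean (`mul_rpow_mul_sq_add_sq_rpow_le`), with equality for `b = 1` and `x = y`.

**Polynomials.** Let `R` be the reciprocal of the curvature bound. Parametrize the boundary by the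
argument `θ` of the normal (`inverseGauss`, with the conjugate exponent `q > 2`); this map is
differentiable, also at the vertices, and its derivative is the curvature radius, at most `R`, times
the unit tangent. Monotonicity of one trigonometric expression then gives Blaschke's theorem: every
boundary point lies on a circle of radius `R` that encloses the ellipse (`exists_enclosing_disk`).
At a boundary point where `|f|` is largest, which exists by the maximum principle, each zero
contributes at least `1 / (2 R)` to the normal component of `f' / f`, which is Turán's argument
(`le_inverseMarkovFactor_of_enclosing_disks`).
-/

/-! ### The odd power `|x| ^ (p - 2) * x` -/

/-- The odd power `|x| ^ (p - 2) * x`, that is, `1 / p` times the derivative of `|x| ^ p`. -/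
noncomputable def oddPow (p x : ℝ) : ℝ := |x| ^ (p - 2) * x

lemma oddPow_zero (p : ℝ) : oddPow p 0 = 0 := by simp [oddPow]

lemma oddPow_mul_self {p : ℝ} (hp : 1 < p) (x : ℝ) : oddPow p x * x = |x| ^ p := by
  rcases eq_or_ne x 0 with rfl | hx
  · simp [oddPow, Real.zero_rpow (by linarith : p ≠ 0)]
  · have : |x| ^ p = |x| ^ (p - 2) * |x| ^ (2 : ℝ) := by
      rw [← Real.rpow_add (abs_pos.2 hx)]; congr 1; ring
    rw [this, oddPow, Real.rpow_two, sq_abs]; ring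

lemma oddPow_sq {p : ℝ} (hp : 1 < p) (x : ℝ) : oddPow p x ^ 2 = |x| ^ (p - 2) * |x| ^ p := by
  rw [← oddPow_mul_self hp, oddPow]; ring

lemma abs_oddPow {p : ℝ} (hp : 1 < p) (x : ℝ) : |oddPow p x| = |x| ^ (p - 1) := by
  rcases eq_or_ne x 0 with rfl | hx
  · simp [oddPow, Real.zero_rpow (by linarith : p - 1 ≠ 0)]
  · rw [oddPow, abs_mul, abs_of_nonneg (by positivity)]
    nth_rw 2 [← Real.rpow_one |x|]
    rw [← Real.rpow_add (abs_pos.2 hx)]; congr 1; ring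

lemma hasDerivAt_abs_rpow_oddPow {p : ℝ} (hp : 1 < p) (x : ℝ) :
    HasDerivAt (fun x : ℝ => |x| ^ p) (p * oddPow p x) x := by
  simpa [oddPow, mul_assoc] using hasDerivAt_abs_rpow x hp

lemma contDiff_abs_rpow {p : ℝ} (hp : 1 < p) : ContDiff ℝ 1 (fun x : ℝ => |x| ^ p) := by
  simpa using contDiff_norm_rpow (E := ℝ) hp

lemma continuous_oddPow {p : ℝ} (hp : 1 < p) : Continuous (oddPow p) := by
  have h := (contDiff_abs_rpow hp).continuous_deriv le_rfl
  have h2 : deriv (fun x : ℝ => |x| ^ p) = fun x => p * oddPow p x :=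
    funext fun x => (hasDerivAt_abs_rpow_oddPow hp x).deriv
  rw [h2] at h
  have h3 := h.const_mul p⁻¹
  convert h3 using 1
  funext x
  field_simp

/-- Away from `0`, or for `p > 2`, the odd power is differentiable. -/
lemma hasDerivAt_oddPow {p : ℝ} {x : ℝ} (h : x ≠ 0 ∨ 2 < p) :
    HasDerivAt (oddPow p) ((p - 1) * |x| ^ (p - 2)) x := by
  rcases eq_or_ne x 0 with rfl | hx
  · have hp : 2 < p := h.resolve_left (by simp)
    rw [abs_zero, Real.zero_rpow (by linarith), mul_zero, hasDerivAt_iff_tendsto_slope_zero]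
    have h1 : Tendsto (fun t : ℝ => |t| ^ (p - 2)) (𝓝[≠] 0) (𝓝 0) := by
      have : ContinuousAt (fun t : ℝ => |t| ^ (p - 2)) 0 :=
        continuous_abs.continuousAt.rpow_const (Or.inr (by linarith))
      have := this.tendsto
      rw [abs_zero, Real.zero_rpow (by linarith)] at this
      exact this.mono_left nhdsWithin_le_nhds
    refine h1.congr' ?_
    filter_upwards [self_mem_nhdsWithin] with t ht
    have ht : t ≠ 0 := ht
    simp only [oddPow, zero_add, mul_zero, sub_zero, smul_eq_mul]
    field_simp
  · have h1 : HasDerivAt (fun y : ℝ => |y|) (SignType.sign x : ℝ) x := hasDerivAt_abs hx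
    have h2 := (h1.rpow_const (p := p - 2) (Or.inl (abs_ne_zero.2 hx))).mul (hasDerivAt_id x)
    refine HasDerivAt.congr_deriv (f := oddPow p) h2 ?_
    have h3 : |x| ^ (p - 2) = |x| ^ (p - 2 - 1) * |x| := by
      nth_rw 3 [← Real.rpow_one |x|]
      rw [← Real.rpow_add (abs_pos.2 hx)]; congr 1; ring
    have h4 : (SignType.sign x : ℝ) * x = |x| := by
      simp
    rw [id_eq]
    linear_combination (p - 2) * |x| ^ (p - 2 - 1) * h4 - (p - 2) * h3

/-- The odd powers of conjugate exponents are inverse to each other, and `oddPow q` is homogeneous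
of degree `q - 1`. -/
lemma oddPow_oddPow_div {p q : ℝ} (h : p.HolderConjugate q) (x : ℝ) {g : ℝ} (hg : 0 < g) :
    oddPow q (oddPow p x / g) = x / g ^ (q - 1) := by
  rcases eq_or_ne x 0 with rfl | hx
  · simp [oddPow]
  have hx' := abs_pos.2 hx
  rw [oddPow, abs_div, abs_oddPow h.lt, abs_of_pos hg, Real.div_rpow (by positivity) hg.le,
    ← Real.rpow_mul hx'.le, oddPow]
  have e : (p - 1) * (q - 2) = -(p - 2) := by
    have := h.mul_eq_add; linarith
  have e2 : g ^ (q - 1) = g ^ (q - 2) * g := by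
    nth_rw 3 [← Real.rpow_one g]
    rw [← Real.rpow_add hg]; congr 1; ring
  rw [e, e2, Real.rpow_neg hx'.le]
  have := (Real.rpow_pos_of_pos hx' (p - 2)).ne'
  have := (Real.rpow_pos_of_pos hg (q - 2)).ne'
  field_simp

/-! ### The sharp inequality behind the curvature bound -/

/-- Equality holds for `a = c`. -/
lemma mul_rpow_mul_sq_add_sq_rpow_le {q : ℝ} (hq : 2 < q) {a c : ℝ} (ha : 0 ≤ a) (hc : 0 ≤ c) :
    (a * c) ^ (q - 2) * (a ^ 2 + c ^ 2) ^ (3 / 2 : ℝ) ≤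
      2 ^ (1 / q - 1 / 2) * (a ^ q + c ^ q) ^ (2 - 1 / q) := by
  have hq0 : 0 < q := by linarith
  set T := (a ^ q + c ^ q) / 2 with hT
  have hA : 0 ≤ a ^ q := by positivity
  have hC : 0 ≤ c ^ q := by positivity
  have hT0 : 0 ≤ T := by positivity
  -- the power mean inequality
  have h1 : a ^ 2 + c ^ 2 ≤ 2 * T ^ (2 / q) := by
    have hcv := (Real.concaveOn_rpow (p := 2 / q) (by positivity)
      (by rw [div_le_one hq0]; exact hq.le)).2 (Set.mem_Ici.2 hA) (Set.mem_Ici.2 hC)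
      (by norm_num : (0 : ℝ) ≤ 1 / 2) (by norm_num : (0 : ℝ) ≤ 1 / 2) (by norm_num)
    simp only [smul_eq_mul] at hcv
    rw [← Real.rpow_mul ha, ← Real.rpow_mul hc, mul_div_cancel₀ _ hq0.ne', Real.rpow_two,
      Real.rpow_two, show 1 / 2 * a ^ q + 1 / 2 * c ^ q = T by rw [hT]; ring] at hcv
    linarith
  -- the inequality of the arithmetic and the geometric mean
  have h2 : a * c ≤ T ^ (2 / q) := by
    have : (a * c) ^ q ≤ T ^ (2 : ℝ) := by
      rw [Real.mul_rpow ha hc, Real.rpow_two, hT]; nlinarith [sq_nonneg (a ^ q - c ^ q)]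
    have h := Real.rpow_le_rpow (by positivity) this (by positivity : 0 ≤ 1 / q)
    rwa [← Real.rpow_mul (by positivity), ← Real.rpow_mul hT0, mul_one_div_cancel hq0.ne',
      Real.rpow_one, mul_one_div] at h
  have h3 : (2 : ℝ) ^ (1 / q - 1 / 2) * (a ^ q + c ^ q) ^ (2 - 1 / q)
      = 2 ^ (3 / 2 : ℝ) * T ^ (2 - 1 / q) := by
    rw [show a ^ q + c ^ q = 2 * T by rw [hT]; ring, Real.mul_rpow (by norm_num) hT0, ← mul_assoc,
      ← Real.rpow_add (by norm_num)]
    congr 2; ring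
  have e1 : T ^ (2 - 1 / q) = (T ^ (2 / q)) ^ (q - 2) * (T ^ (2 / q)) ^ (3 / 2 : ℝ) := by
    rw [← Real.rpow_mul hT0, ← Real.rpow_mul hT0, ← Real.rpow_add_of_nonneg hT0]
    · congr 1; field_simp; ring
    · have : 0 ≤ q - 2 := by linarith
      positivity
    · positivity
  rw [h3, e1]
  calc _ ≤ (T ^ (2 / q)) ^ (q - 2) * (2 * T ^ (2 / q)) ^ (3 / 2 : ℝ) := by
        gcongr
    _ = _ := by rw [Real.mul_rpow (by norm_num) (by positivity)]; ring

/-! ### The boundary and the tangent lines of the ellipse -/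

/-- The gradient at `z` of the defining function `|x| ^ p + |y / b| ^ p`, divided by `p`, as a
complex number. It is an outward normal vector at the boundary points. -/
noncomputable def lpNormal (p b : ℝ) (z : ℂ) : ℂ :=
  ⟨oddPow p z.re, oddPow p (z.im / b) / b⟩

lemma continuous_lpFun {p b : ℝ} (hp : 1 < p) :
    Continuous (fun z : ℂ => |z.re| ^ p + |z.im / b| ^ p) := by
  have h := (contDiff_abs_rpow hp).continuous
  exact (h.comp Complex.continuous_re).add (h.comp (Complex.continuous_im.div_const b))

lemma isClosed_lpEllipse {p b : ℝ} (hp : 1 < p) : IsClosed (lpEllipse p b) :=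
  isClosed_le (continuous_lpFun hp) continuous_const

lemma mem_frontier_lpEllipse {p b : ℝ} (hp : 1 < p) {z : ℂ} :
    z ∈ frontier (lpEllipse p b) ↔ |z.re| ^ p + |z.im / b| ^ p = 1 := by
  constructor
  · intro h
    exact frontier_le_subset_eq (continuous_lpFun hp) continuous_const h
  · intro h
    rw [frontier, (isClosed_lpEllipse hp).closure_eq]
    refine ⟨h.le, fun hi => ?_⟩
    have hc : Tendsto (fun t : ℝ => (t : ℂ) * z) (𝓝[>] 1) (𝓝 z) := by
      have : Continuous (fun t : ℝ => (t : ℂ) * z) := by fun_prop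
      simpa using (this.tendsto 1).mono_left nhdsWithin_le_nhds
    obtain ⟨t, ht, ht1⟩ := ((hc.eventually (mem_interior_iff_mem_nhds.1 hi)).and
      self_mem_nhdsWithin).exists
    have ht1 : 1 < t := ht1
    have ht' : |t * z.re| ^ p + |t * z.im / b| ^ p ≤ 1 := by
      have : (t : ℂ) * z ∈ lpEllipse p b := ht
      simpa [lpEllipse] using this
    rw [mul_div_assoc, abs_mul, abs_mul, Real.mul_rpow (abs_nonneg _) (abs_nonneg _),
      Real.mul_rpow (abs_nonneg _) (abs_nonneg _), ← mul_add, h, abs_of_pos (by linarith)] at ht'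
    have := Real.one_lt_rpow ht1 (by linarith : 0 < p)
    linarith

lemma isCompact_lpEllipse {p b : ℝ} (hp : 1 < p) (hb : 0 < b) : IsCompact (lpEllipse p b) := by
  have aux : ∀ s t : ℝ, |s| ^ p + |t| ^ p ≤ 1 → |s| ≤ 1 := by
    intro s t h
    by_contra! hs
    have := Real.one_lt_rpow hs (by linarith : 0 < p)
    have : 0 ≤ |t| ^ p := by positivity
    linarith
  refine Metric.isCompact_of_isClosed_isBounded (isClosed_lpEllipse hp) ?_
  refine (Metric.isBounded_closedBall (x := (0 : ℂ)) (r := 1 + b)).subset fun z hz => ?_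
  have hz : |z.re| ^ p + |z.im / b| ^ p ≤ 1 := hz
  have h1 := aux _ _ hz
  have h2 := aux _ _ (by rwa [add_comm] at hz)
  rw [abs_div, abs_of_pos hb, div_le_one hb] at h2
  rw [mem_closedBall_zero_iff]
  linarith [Complex.norm_le_abs_re_add_abs_im z]

lemma zero_mem_lpEllipse {p b : ℝ} (hp : 1 < p) : (0 : ℂ) ∈ lpEllipse p b := by
  simp [lpEllipse, Real.zero_rpow (by linarith : p ≠ 0)]

/-- Euler's identity for the homogeneous defining function. -/
lemma lpNormal_inner_self {p b : ℝ} (hp : 1 < p) (z : ℂ) :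
    (lpNormal p b z).re * z.re + (lpNormal p b z).im * z.im = |z.re| ^ p + |z.im / b| ^ p := by
  rw [← oddPow_mul_self hp z.re, ← oddPow_mul_self hp (z.im / b)]
  simp only [lpNormal]; ring

lemma lpNormal_inner_le {p b : ℝ} (hp : 1 < p) {z w : ℂ} (hz : |z.re| ^ p + |z.im / b| ^ p = 1)
    (hw : w ∈ lpEllipse p b) :
    (lpNormal p b z).re * w.re + (lpNormal p b z).im * w.im ≤ 1 := by
  have hpq := Real.HolderConjugate.conjExponent hp
  set q := p.conjExponent
  have hw : |w.re| ^ p + |w.im / b| ^ p ≤ 1 := hw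
  have key : ∀ s t : ℝ, oddPow p s * t ≤ |t| ^ p / p + |s| ^ p / q := by
    intro s t
    have := Real.young_inequality t (oddPow p s) hpq
    rw [abs_oddPow hp, ← Real.rpow_mul (abs_nonneg _), hpq.sub_one_mul_conj] at this
    linarith
  have h1 := key z.re w.re
  have h2 := key (z.im / b) (w.im / b)
  have e : (lpNormal p b z).im * w.im = oddPow p (z.im / b) * (w.im / b) := by
    simp only [lpNormal]; ring
  have e1 : (lpNormal p b z).re = oddPow p z.re := rfl
  rw [e, e1]
  have h3 : (|w.re| ^ p + |w.im / b| ^ p) / p + (|z.re| ^ p + |z.im / b| ^ p) / q ≤ 1 := by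
    rw [hz]
    have := hpq.inv_add_inv_eq_one
    have hp' : (|w.re| ^ p + |w.im / b| ^ p) / p ≤ 1 / p := by
      have := hpq.pos
      gcongr
    rw [one_div] at *
    linarith
  calc _ ≤ (|w.re| ^ p / p + |z.re| ^ p / q) + (|w.im / b| ^ p / p + |z.im / b| ^ p / q) :=
        add_le_add h1 h2
    _ = (|w.re| ^ p + |w.im / b| ^ p) / p + (|z.re| ^ p + |z.im / b| ^ p) / q := by ring
    _ ≤ 1 := h3

lemma lpNormal_ne_zero {p b : ℝ} (hp : 1 < p) {z : ℂ} (hz : |z.re| ^ p + |z.im / b| ^ p = 1) :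
    lpNormal p b z ≠ 0 := by
  intro h
  have := lpNormal_inner_self (b := b) hp z
  rw [h, hz] at this
  simp at this

lemma continuous_lpNormal {p b : ℝ} (hp : 1 < p) : Continuous (lpNormal p b) := by
  have h1 := (continuous_oddPow hp).comp Complex.continuous_re
  have h2 := ((continuous_oddPow hp).comp (Complex.continuous_im.div_const b)).div_const b
  have := (Complex.continuous_ofReal.comp h1).add
    ((Complex.continuous_ofReal.comp h2).mul_const Complex.I)
  convert this using 1
  funext z
  apply Complex.ext <;> simp [lpNormal]

/-- A differentiable curve that stays in the boundary has velocity orthogonal to the normal. -/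
lemma lpNormal_inner_deriv_eq_zero {p b : ℝ} (hp : 1 < p) {γ : ℝ → ℂ} {d : ℂ} {t : ℝ}
    (hγ : HasDerivAt γ d t)
    (hF : ∀ᶠ u in 𝓝 t, |(γ u).re| ^ p + |(γ u).im / b| ^ p = 1) :
    (lpNormal p b (γ t)).re * d.re + (lpNormal p b (γ t)).im * d.im = 0 := by
  have hre : HasDerivAt (fun u => (γ u).re) d.re t :=
    Complex.reCLM.hasFDerivAt.comp_hasDerivAt t hγ
  have him : HasDerivAt (fun u => (γ u).im) d.im t :=
    Complex.imCLM.hasFDerivAt.comp_hasDerivAt t hγ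
  have h1 := (hasDerivAt_abs_rpow_oddPow hp (γ t).re).comp t hre
  have h2 := (hasDerivAt_abs_rpow_oddPow hp ((γ t).im / b)).comp t (him.div_const b)
  have h3 := (h1.add h2).unique ((hasDerivAt_const t (1 : ℝ)).congr_of_eventuallyEq hF)
  have h4 : p * ((lpNormal p b (γ t)).re * d.re + (lpNormal p b (γ t)).im * d.im) = 0 := by
    rw [← h3]; simp only [lpNormal]; ring
  exact (mul_eq_zero.1 h4).resolve_left (by linarith)

/-- A vector orthogonal to the normal at a boundary point is a real multiple of the normal turned
by a right angle; the multiple is the wedge product of the point and the vector. -/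
lemma eq_smul_I_mul_lpNormal {p b : ℝ} (hp : 1 < p) {z d : ℂ}
    (hz : |z.re| ^ p + |z.im / b| ^ p = 1)
    (h : (lpNormal p b z).re * d.re + (lpNormal p b z).im * d.im = 0) :
    d = ((z.re * d.im - z.im * d.re : ℝ) : ℂ) * (Complex.I * lpNormal p b z) := by
  have h1 := lpNormal_inner_self (b := b) hp z
  rw [hz] at h1
  apply Complex.ext
  · simp
    linear_combination z.re * h - d.re * h1
  · simp
    linear_combination z.im * h - d.im * h1

/-! ### The inverse Gauss map and a rolling disk -/

/-- The function `|cos θ| ^ q + |b sin θ| ^ q`. When `q` is conjugate to `p`, its power with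
exponent `1 / q` is the support function of the ellipse with parameters `p` and `b`; its power with
exponent `-1 / q` is the radius, in the direction `θ`, of the ellipse with parameters `q`
and `b⁻¹`. -/
noncomputable def polarSum (q b θ : ℝ) : ℝ := |Real.cos θ| ^ q + |b * Real.sin θ| ^ q

/-- The inverse Gauss map of the ellipse, for conjugate exponents `p` and `q`: the boundary point
at which the outward normal has argument `θ`. -/
noncomputable def inverseGauss (p q b θ : ℝ) : ℂ :=
  ⟨polarSum q b θ ^ (-(1 / p)) * oddPow q (Real.cos θ),
    b * (polarSum q b θ ^ (-(1 / p)) * oddPow q (b * Real.sin θ))⟩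

/-- The radius of curvature at the boundary point where the outward normal has argument `θ`. -/
noncomputable def curvatureRadius (p q b θ : ℝ) : ℝ :=
  (q - 1) * b ^ 2 * polarSum q b θ ^ (-(1 / p) - 1) *
    (|Real.cos θ| ^ (q - 2) * |b * Real.sin θ| ^ (q - 2))

lemma polarSum_pos {q b : ℝ} (hb : 0 < b) (θ : ℝ) : 0 < polarSum q b θ := by
  rcases eq_or_ne (Real.cos θ) 0 with h | h
  · have hs : Real.sin θ ≠ 0 := by
      intro hs
      have := Real.sin_sq_add_cos_sq θ
      rw [h, hs] at this
      norm_num at this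
    have : 0 < |b * Real.sin θ| ^ q := Real.rpow_pos_of_pos (abs_pos.2 (mul_ne_zero hb.ne' hs)) _
    have : 0 ≤ |Real.cos θ| ^ q := by positivity
    unfold polarSum
    linarith
  · have : 0 < |Real.cos θ| ^ q := Real.rpow_pos_of_pos (abs_pos.2 h) _
    have : 0 ≤ |b * Real.sin θ| ^ q := by positivity
    unfold polarSum
    linarith

/-- The inverse Gauss map moves in the tangent direction, at the speed of the curvature radius. -/
lemma hasDerivAt_inverseGauss {p q b : ℝ} (h : p.HolderConjugate q) (hq : 2 < q) (hb : 0 < b)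
    (θ : ℝ) :
    HasDerivAt (fun θ => (inverseGauss p q b θ).re) (-curvatureRadius p q b θ * Real.sin θ) θ ∧
    HasDerivAt (fun θ => (inverseGauss p q b θ).im) (curvatureRadius p q b θ * Real.cos θ) θ := by
  have hq1 : 1 < q := by linarith
  have hS0 := polarSum_pos (q := q) hb θ
  have hc := Real.hasDerivAt_cos θ
  have hs := (Real.hasDerivAt_sin θ).const_mul b
  have hS : HasDerivAt (polarSum q b) _ θ :=
    ((hasDerivAt_abs_rpow_oddPow hq1 _).comp θ hc).add
      ((hasDerivAt_abs_rpow_oddPow hq1 _).comp θ hs)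
  have hSp := hS.rpow_const (p := -(1 / p)) (Or.inl hS0.ne')
  have h1 := hSp.mul ((hasDerivAt_oddPow (Or.inr hq)).comp θ hc)
  have h2 := (hSp.mul ((hasDerivAt_oddPow (Or.inr hq)).comp θ hs)).const_mul b
  have e1 : polarSum q b θ ^ (-(1 / p)) = polarSum q b θ ^ (-(1 / p) - 1) * polarSum q b θ := by
    nth_rw 3 [← Real.rpow_one (polarSum q b θ)]
    rw [← Real.rpow_add hS0]; congr 1; ring
  have e2 : polarSum q b θ = |Real.cos θ| ^ (q - 2) * Real.cos θ ^ 2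
      + |b * Real.sin θ| ^ (q - 2) * (b * Real.sin θ) ^ 2 := by
    rw [polarSum, ← oddPow_mul_self hq1, ← oddPow_mul_self hq1, oddPow, oddPow]; ring
  have e3 : q * (1 / p) = q - 1 := by
    have := h.mul_eq_add
    have := h.pos
    field_simp
    linarith
  have hcs := Real.sin_sq_add_cos_sq θ
  constructor
  · refine HasDerivAt.congr_deriv (f := fun θ => (inverseGauss p q b θ).re) h1 ?_
    simp only [curvatureRadius, Function.comp_apply, oddPow]
    rw [e1]
    set U := polarSum q b θ ^ (-(1 / p) - 1)
    rw [e2]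
    set A := |Real.cos θ| ^ (q - 2)
    set B := |b * Real.sin θ| ^ (q - 2)
    set c := Real.cos θ
    set s := Real.sin θ
    linear_combination
      U * A * c * (A * c * s - B * b ^ 2 * s * c) * e3 - (q - 1) * U * A * B * b ^ 2 * s * hcs
  · refine HasDerivAt.congr_deriv (f := fun θ => (inverseGauss p q b θ).im) h2 ?_
    simp only [curvatureRadius, Function.comp_apply, oddPow]
    rw [e1]
    set U := polarSum q b θ ^ (-(1 / p) - 1)
    rw [e2]
    set A := |Real.cos θ| ^ (q - 2)
    set B := |b * Real.sin θ| ^ (q - 2)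
    set c := Real.cos θ
    set s := Real.sin θ
    linear_combination
      U * b * B * b * s * (A * c * s - B * b ^ 2 * s * c) * e3
        + (q - 1) * U * A * B * b ^ 2 * c * hcs

lemma curvatureRadius_le {p q b : ℝ} (h : p.HolderConjugate q) (hq : 2 < q) (hb : 0 < b)
    (hb1 : b ≤ 1) (θ : ℝ) :
    curvatureRadius p q b θ ≤ (q - 1) * 2 ^ (1 / q - 1 / 2) / b := by
  have hS0 := polarSum_pos (q := q) hb θ
  have key := mul_rpow_mul_sq_add_sq_rpow_le hq (abs_nonneg (Real.cos θ))
    (abs_nonneg (b * Real.sin θ))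
  rw [Real.mul_rpow (abs_nonneg _) (abs_nonneg _), sq_abs, sq_abs] at key
  change _ ≤ _ * polarSum q b θ ^ _ at key
  have e : 2 - 1 / q = 1 / p + 1 := by
    have := h.inv_add_inv_eq_one
    rw [one_div, one_div]; linarith
  have h1 : b ^ 3 ≤ (Real.cos θ ^ 2 + (b * Real.sin θ) ^ 2) ^ (3 / 2 : ℝ) := by
    have : b ^ 3 = (b ^ 2) ^ (3 / 2 : ℝ) := by
      rw [← Real.rpow_natCast b 2, ← Real.rpow_mul hb.le, ← Real.rpow_natCast]; norm_num
    rw [this]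
    apply Real.rpow_le_rpow (by positivity) _ (by norm_num)
    have := Real.sin_sq_add_cos_sq θ
    have hb2 : b ^ 2 ≤ 1 := pow_le_one₀ hb.le hb1
    nlinarith [mul_nonneg (sub_nonneg.2 hb2) (sq_nonneg (Real.cos θ))]
  rw [e] at key
  have e2 : polarSum q b θ ^ (-(1 / p) - 1) = (polarSum q b θ ^ (1 / p + 1))⁻¹ := by
    rw [← Real.rpow_neg hS0.le]; congr 1; ring
  rw [curvatureRadius, e2]
  set A := |Real.cos θ| ^ (q - 2) * |b * Real.sin θ| ^ (q - 2)
  have hA : 0 ≤ A := by positivity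
  set W := polarSum q b θ ^ (1 / p + 1)
  have hW : 0 < W := Real.rpow_pos_of_pos hS0 _
  have h2 : A * b ^ 3 ≤ 2 ^ (1 / q - 1 / 2) * W := (mul_le_mul_of_nonneg_left h1 hA).trans key
  rw [le_div_iff₀ hb]
  calc (q - 1) * b ^ 2 * W⁻¹ * A * b = (q - 1) * ((A * b ^ 3) / W) := by ring
    _ ≤ (q - 1) * 2 ^ (1 / q - 1 / 2) := by
        apply mul_le_mul_of_nonneg_left _ (by linarith)
        rwa [div_le_iff₀ hW]

lemma inverseGauss_eq_div {p q b : ℝ} (hb : 0 < b) (θ : ℝ) :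
    (inverseGauss p q b θ).re = oddPow q (Real.cos θ) / polarSum q b θ ^ (1 / p) ∧
    (inverseGauss p q b θ).im / b = oddPow q (b * Real.sin θ) / polarSum q b θ ^ (1 / p) := by
  simp only [inverseGauss, Real.rpow_neg (polarSum_pos (q := q) hb θ).le]
  constructor
  · ring
  · field_simp

lemma inverseGauss_boundary {p q b : ℝ} (h : p.HolderConjugate q) (hb : 0 < b) (θ : ℝ) :
    |(inverseGauss p q b θ).re| ^ p + |(inverseGauss p q b θ).im / b| ^ p = 1 := by
  have hS0 := polarSum_pos (q := q) hb θ
  obtain ⟨h1, h2⟩ := inverseGauss_eq_div (p := p) (q := q) hb θ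
  have aux : ∀ t, |oddPow q t / polarSum q b θ ^ (1 / p)| ^ p = |t| ^ q / polarSum q b θ := by
    intro t
    rw [abs_div, abs_oddPow h.symm.lt, abs_of_pos (Real.rpow_pos_of_pos hS0 _),
      Real.div_rpow (by positivity) (by positivity), ← Real.rpow_mul (abs_nonneg _),
      ← Real.rpow_mul hS0.le, h.symm.sub_one_mul_conj, one_div_mul_cancel h.pos.ne',
      Real.rpow_one]
  rw [h1, h2, aux, aux, ← add_div]
  exact div_self hS0.ne'

lemma lpNormal_inverseGauss {p q b : ℝ} (h : p.HolderConjugate q) (hb : 0 < b) (θ : ℝ) :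
    lpNormal p b (inverseGauss p q b θ) =
      ⟨Real.cos θ / (polarSum q b θ ^ (1 / p)) ^ (p - 1),
        Real.sin θ / (polarSum q b θ ^ (1 / p)) ^ (p - 1)⟩ := by
  have hS0 := polarSum_pos (q := q) hb θ
  obtain ⟨h1, h2⟩ := inverseGauss_eq_div (p := p) (q := q) hb θ
  have hpos := Real.rpow_pos_of_pos hS0 (1 / p)
  rw [lpNormal, h1, h2, oddPow_oddPow_div h.symm _ hpos, oddPow_oddPow_div h.symm _ hpos]
  congr 1
  field_simp

/-- The support function of the ellipse is attained at the value of the inverse Gauss map. -/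
lemma inner_le_inner_inverseGauss {p q b : ℝ} (h : p.HolderConjugate q) (hb : 0 < b) (θ : ℝ)
    {w : ℂ} (hw : w ∈ lpEllipse p b) :
    w.re * Real.cos θ + w.im * Real.sin θ ≤
      (inverseGauss p q b θ).re * Real.cos θ + (inverseGauss p q b θ).im * Real.sin θ := by
  have hS0 := polarSum_pos (q := q) hb θ
  have hF := inverseGauss_boundary h hb θ
  have h1 := lpNormal_inner_le h.lt hF hw
  have h2 := lpNormal_inner_self (b := b) h.lt (inverseGauss p q b θ)
  rw [hF] at h2
  rw [lpNormal_inverseGauss h hb] at h1 h2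
  set U := (polarSum q b θ ^ (1 / p)) ^ (p - 1)
  have hU : 0 < U := Real.rpow_pos_of_pos (Real.rpow_pos_of_pos hS0 _) _
  have h3 : (w.re * Real.cos θ + w.im * Real.sin θ) / U ≤
      ((inverseGauss p q b θ).re * Real.cos θ + (inverseGauss p q b θ).im * Real.sin θ) / U := by
    calc _ = Real.cos θ / U * w.re + Real.sin θ / U * w.im := by ring
      _ ≤ 1 := h1
      _ = _ := h2.symm
      _ = _ := by ring
  exact (div_le_div_iff_of_pos_right hU).1 h3

lemma inverseGauss_arg_lpNormal {p q b : ℝ} (h : p.HolderConjugate q) (hb : 0 < b) {z : ℂ}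
    (hz : |z.re| ^ p + |z.im / b| ^ p = 1) :
    inverseGauss p q b (lpNormal p b z).arg = z := by
  have hg : 0 < ‖lpNormal p b z‖ := norm_pos_iff.2 (lpNormal_ne_zero h.lt hz)
  set θ := (lpNormal p b z).arg
  set g := ‖lpNormal p b z‖
  have hc : Real.cos θ = oddPow p z.re / g := Complex.cos_arg (norm_pos_iff.1 hg)
  have hs : b * Real.sin θ = oddPow p (z.im / b) / g := by
    have : Real.sin θ = (oddPow p (z.im / b) / b) / g := Complex.sin_arg _
    rw [this]; field_simp
  have aux : ∀ t, |oddPow p t / g| ^ q = |t| ^ p / g ^ q := by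
    intro t
    rw [abs_div, abs_oddPow h.lt, abs_of_pos hg, Real.div_rpow (by positivity) hg.le,
      ← Real.rpow_mul (abs_nonneg _), h.sub_one_mul_conj]
  have hS : polarSum q b θ = 1 / g ^ q := by
    rw [polarSum, hc, hs, aux, aux, ← add_div, hz]
  have hS2 : polarSum q b θ ^ (-(1 / p)) = g ^ (q - 1) := by
    rw [hS, one_div, ← Real.rpow_neg hg.le, ← Real.rpow_mul hg.le]
    congr 1
    have := h.mul_eq_add
    have := h.pos
    field_simp
    linarith
  have hgq := (Real.rpow_pos_of_pos hg (q - 1)).ne'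
  apply Complex.ext
  · simp only [inverseGauss]
    rw [hS2, hc, oddPow_oddPow_div h _ hg]
    field_simp
  · simp only [inverseGauss]
    rw [hS2, hs, oddPow_oddPow_div h _ hg]
    field_simp

/-- Blaschke's rolling theorem for the ellipse. With `u` the unit normal at angle `θ`, the
centre `inverseGauss θ - R u` moves in the tangent direction with speed `curvatureRadius - R ≤ 0`;
so its component in the direction `ψ`, within a half turn, is least for `θ = ψ`. -/
lemma support_sub_le_inner_center {p q b R : ℝ} (h : p.HolderConjugate q) (hq : 2 < q)
    (hb : 0 < b) (hR : ∀ θ, curvatureRadius p q b θ ≤ R) {θ ψ : ℝ} (h1 : -Real.pi ≤ ψ - θ)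
    (h2 : ψ - θ ≤ Real.pi) :
    (inverseGauss p q b ψ).re * Real.cos ψ + (inverseGauss p q b ψ).im * Real.sin ψ - R ≤
      ((inverseGauss p q b θ).re - R * Real.cos θ) * Real.cos ψ +
        ((inverseGauss p q b θ).im - R * Real.sin θ) * Real.sin ψ := by
  set m : ℝ → ℝ := fun θ => ((inverseGauss p q b θ).re - R * Real.cos θ) * Real.cos ψ +
        ((inverseGauss p q b θ).im - R * Real.sin θ) * Real.sin ψ with hm
  have hd : ∀ t, HasDerivAt m ((curvatureRadius p q b t - R) * Real.sin (ψ - t)) t := by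
    intro t
    obtain ⟨d1, d2⟩ := hasDerivAt_inverseGauss h hq hb t
    have := ((d1.sub ((Real.hasDerivAt_cos t).const_mul R)).mul_const (Real.cos ψ)).add
      ((d2.sub ((Real.hasDerivAt_sin t).const_mul R)).mul_const (Real.sin ψ))
    refine HasDerivAt.congr_deriv (f := m) this ?_
    rw [Real.sin_sub]; ring
  have hcont : Continuous m := continuous_iff_continuousAt.2 fun t => (hd t).continuousAt
  have hψ : m ψ = (inverseGauss p q b ψ).re * Real.cos ψ
      + (inverseGauss p q b ψ).im * Real.sin ψ - R := by
    have := Real.sin_sq_add_cos_sq ψ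
    simp only [hm]
    linear_combination -R * this
  rw [← hψ]
  change m ψ ≤ m θ
  rcases le_total θ ψ with hle | hle
  · have : AntitoneOn m (Icc θ ψ) := by
      refine antitoneOn_of_deriv_nonpos (convex_Icc _ _) hcont.continuousOn
        (fun t _ => (hd t).differentiableAt.differentiableWithinAt) fun t ht => ?_
      rw [interior_Icc] at ht
      rw [(hd t).deriv]
      exact mul_nonpos_of_nonpos_of_nonneg (by linarith [hR t])
        (Real.sin_nonneg_of_nonneg_of_le_pi (by linarith [ht.2]) (by linarith [ht.1]))
    exact this (left_mem_Icc.2 hle) (right_mem_Icc.2 hle) hle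
  · have : MonotoneOn m (Icc ψ θ) := by
      refine monotoneOn_of_deriv_nonneg (convex_Icc _ _) hcont.continuousOn
        (fun t _ => (hd t).differentiableAt.differentiableWithinAt) fun t ht => ?_
      rw [interior_Icc] at ht
      rw [(hd t).deriv]
      exact mul_nonneg_of_nonpos_of_nonpos (by linarith [hR t])
        (Real.sin_nonpos_of_nonpos_of_neg_pi_le (by linarith [ht.1]) (by linarith [ht.2]))
    exact this (left_mem_Icc.2 hle) (right_mem_Icc.2 hle) hle

/-- Every boundary point lies on a circle of radius `R` whose closed disk contains the ellipse; the
direction `e` from the centre to a point `w` of the ellipse is compared with the support function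
in that direction. -/
lemma exists_enclosing_disk {p q b R : ℝ} (h : p.HolderConjugate q) (hq : 2 < q)
    (hb : 0 < b) (hR : ∀ θ, curvatureRadius p q b θ ≤ R) {z : ℂ}
    (hz : z ∈ frontier (lpEllipse p b)) :
    ∃ u : ℂ, ‖u‖ = 1 ∧ ∀ w ∈ lpEllipse p b, ‖w - (z - R * u)‖ ≤ R := by
  rw [mem_frontier_lpEllipse h.lt] at hz
  set θ := (lpNormal p b z).arg with hθ
  refine ⟨Complex.exp (θ * Complex.I), Complex.norm_exp_ofReal_mul_I θ, fun w hw => ?_⟩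
  set u := Complex.exp (θ * Complex.I) with hu
  set e := w - (z - R * u) with he
  -- `ψ` is the argument of `e` that lies within a half turn of `θ`
  set ψ := θ + (e * Complex.exp (-(θ * Complex.I))).arg with hψ
  have hpolar : e = ‖e‖ * Complex.exp (ψ * Complex.I) := by
    have h1 := Complex.norm_mul_exp_arg_mul_I (e * Complex.exp (-(θ * Complex.I)))
    have h2 : ‖e * Complex.exp (-(θ * Complex.I))‖ = ‖e‖ := by
      rw [norm_mul, show -(θ * Complex.I) = ((-θ : ℝ) : ℂ) * Complex.I by push_cast; ring,
        Complex.norm_exp_ofReal_mul_I, mul_one]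
    rw [h2] at h1
    rw [hψ, Complex.ofReal_add, add_mul, Complex.exp_add, mul_left_comm, h1, mul_left_comm,
      ← Complex.exp_add, add_neg_cancel, Complex.exp_zero, mul_one]
  have hre : e.re = ‖e‖ * Real.cos ψ := by
    conv_lhs => rw [hpolar]
    rw [Complex.re_ofReal_mul, Complex.exp_ofReal_mul_I_re]
  have him : e.im = ‖e‖ * Real.sin ψ := by
    conv_lhs => rw [hpolar]
    rw [Complex.im_ofReal_mul, Complex.exp_ofReal_mul_I_im]
  have hn : ‖e‖ = e.re * Real.cos ψ + e.im * Real.sin ψ := by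
    rw [hre, him]
    have := Real.sin_sq_add_cos_sq ψ
    linear_combination -‖e‖ * this
  have hre' : e.re = w.re - (z.re - R * Real.cos θ) := by
    simp [he, hu, Complex.exp_ofReal_mul_I_re]
  have him' : e.im = w.im - (z.im - R * Real.sin θ) := by
    simp [he, hu, Complex.exp_ofReal_mul_I_im]
  have hs := inner_le_inner_inverseGauss h hb ψ hw
  have hc := support_sub_le_inner_center h hq hb hR (θ := θ) (ψ := ψ)
    (by rw [hψ, add_sub_cancel_left]; exact (Complex.neg_pi_lt_arg _).le)
    (by rw [hψ, add_sub_cancel_left]; exact Complex.arg_le_pi _)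
  rw [hθ, inverseGauss_arg_lpNormal h hb hz, ← hθ] at hc
  rw [hn, hre', him']
  linarith

/-! ### Turán's lemma -/

/-- If `w` lies in a disk of radius `R` with boundary point `z` and outward unit normal `u` there,
then the real part of `u / (z - w)` is at least `1 / (2 R)`. -/
lemma one_div_two_mul_le_re_div {R : ℝ} (hR : 0 < R) {z w u : ℂ} (hu : ‖u‖ = 1) (hzw : z ≠ w)
    (h : ‖w - (z - R * u)‖ ≤ R) : 1 / (2 * R) ≤ (u * (1 / (z - w))).re := by
  have hd : 0 < Complex.normSq (z - w) := Complex.normSq_pos.2 (sub_ne_zero.2 hzw)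
  have h2 : Complex.normSq (w - (z - R * u)) ≤ R ^ 2 := by
    rw [Complex.normSq_eq_norm_sq]
    exact pow_le_pow_left₀ (norm_nonneg _) h 2
  have hu2 : Complex.normSq u = 1 := by rw [Complex.normSq_eq_norm_sq, hu, one_pow]
  have e : (u * (1 / (z - w))).re =
      (u.re * (z - w).re + u.im * (z - w).im) / Complex.normSq (z - w) := by
    rw [one_div, Complex.mul_re, Complex.inv_re, Complex.inv_im]; ring
  rw [e, div_le_div_iff₀ (by positivity) hd]
  rw [Complex.normSq_apply] at h2 hu2 ⊢
  simp at h2 ⊢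
  nlinarith

/-- Turán's lower bound for sets such that every boundary point is a point of contact with an
enclosing circle of radius `R`: at a boundary point where `|q|` is largest, every zero contributes
at least `1 / (2 R)` to the normal component of the logarithmic derivative of `q`. -/
theorem le_inverseMarkovFactor_of_enclosing_disks {K : Set ℂ} {R : ℝ} (hR : 0 < R)
    (hK : IsCompact K) (hinf : K.Infinite)
    (hdisk : ∀ z ∈ frontier K, ∃ u : ℂ, ‖u‖ = 1 ∧ ∀ w ∈ K, ‖w - (z - R * u)‖ ≤ R) (n : ℕ) :
    1 / (2 * R) * n ≤ inverseMarkovFactor n K := by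
  obtain ⟨a, ha⟩ := hinf.nonempty
  refine le_csInf (Set.Nonempty.image _ ⟨(Polynomial.X - Polynomial.C a) ^ n, ?_, ?_⟩) ?_
  · rw [Polynomial.degree_pow, Polynomial.degree_X_sub_C]; simp
  · intro z hz
    rw [Polynomial.IsRoot, Polynomial.eval_pow, Polynomial.eval_sub, Polynomial.eval_X,
      Polynomial.eval_C] at hz
    rwa [sub_eq_zero.1 (eq_zero_of_pow_eq_zero hz)]
  rintro _ ⟨f, ⟨hdeg, hroots⟩, rfl⟩
  have hf0 : f ≠ 0 := by
    rintro rfl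
    simp at hdeg
  have hbdd : ∀ g : Polynomial ℂ, BddAbove ((fun z => ‖g.eval z‖) '' K) := fun g =>
    (hK.image (by fun_prop)).bddAbove
  obtain ⟨z, hzK, hz⟩ := Complex.exists_mem_frontier_isMaxOn_norm (f := fun z => f.eval z)
    hK.isBounded hinf.nonempty f.differentiable.diffContOnCl
  have hzmem : z ∈ K := hK.isClosed.frontier_subset hzK
  rw [hK.isClosed.closure_eq] at hz
  have hz0 : f.eval z ≠ 0 := by
    intro h0
    refine hf0 (Polynomial.eq_zero_of_infinite_isRoot f (hinf.mono fun w hw => ?_))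
    have := hz hw
    simp only [mem_ofPred_eq, Function.comp_apply, h0, norm_zero] at this
    exact norm_le_zero_iff.1 this
  have hnorm : polyNorm K f = ‖f.eval z‖ :=
    le_antisymm (csSup_le (hinf.nonempty.image _) (by rintro _ ⟨w, hw, rfl⟩; exact hz hw))
      (le_csSup (hbdd f) ⟨z, hzmem, rfl⟩)
  obtain ⟨u, hu, hw⟩ := hdisk z hzK
  have hlog : 1 / (2 * R) * n ≤ ‖f.derivative.eval z / f.eval z‖ := by
    calc 1 / (2 * R) * n ≤ (u * (f.derivative.eval z / f.eval z)).re := by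
          have hs := IsAlgClosed.splits f
          rw [hs.eval_derivative_div_eval_of_ne_zero hz0, ← Multiset.sum_map_mul_left]
          have hcard : f.roots.card = n := by
            rw [← hs.natDegree_eq_card_roots]
            exact Polynomial.natDegree_eq_of_degree_eq_some hdeg
          have hre : ∀ s : Multiset ℂ, s.sum.re = (s.map Complex.re).sum := fun s =>
            map_multiset_sum Complex.reLm s
          rw [hre, Multiset.map_map, ← hcard, mul_comm, ← nsmul_eq_mul]
          have := Multiset.card_nsmul_le_sum (s := f.roots.map
            (Complex.re ∘ fun w => u * (1 / (z - w)))) (a := 1 / (2 * R)) ?_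
          · rwa [Multiset.card_map] at this
          · intro t ht
            obtain ⟨w, hwr, rfl⟩ := Multiset.mem_map.1 ht
            have hwr := Polynomial.isRoot_of_mem_roots hwr
            refine one_div_two_mul_le_re_div hR hu ?_ (hw w (hroots w hwr))
            rintro rfl
            exact hz0 hwr
      _ ≤ ‖u * (f.derivative.eval z / f.eval z)‖ := Complex.re_le_norm _
      _ = _ := by rw [norm_mul, hu, one_mul]
  refine hlog.trans ?_
  rw [norm_div, ← hnorm]
  have : 0 < polyNorm K f := hnorm ▸ norm_pos_iff.2 hz0
  simp only
  gcongr
  exact le_csSup (hbdd _) ⟨z, hzmem, rfl⟩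

/-- The radius of the enclosing disks is the reciprocal of the lower bound for the curvature. -/
theorem le_inverseMarkovFactor_lpEllipse {p b : ℝ} (hp1 : 1 < p) (hp2 : p < 2) (hb : 0 < b)
    (hb1 : b ≤ 1) (n : ℕ) :
    (p - 1) * b * 2 ^ (1 / p - 3 / 2) * (n : ℝ) ≤ inverseMarkovFactor n (lpEllipse p b) := by
  have h := Real.HolderConjugate.conjExponent hp1
  set q := p.conjExponent with hqdef
  have hmul : (p - 1) * (q - 1) = 1 := by linarith [h.mul_eq_add]
  have hq : 2 < q := by nlinarith
  have hR : 0 < (q - 1) * 2 ^ (1 / q - 1 / 2) / b := by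
    have : 0 < q - 1 := by linarith
    positivity
  have hinf : (lpEllipse p b).Infinite := by
    apply infinite_of_mem_nhds (0 : ℂ)
    refine Filter.mem_of_superset ((isOpen_lt (continuous_lpFun (b := b) hp1)
      continuous_const).mem_nhds (?_ : _ < (1 : ℝ))) fun z hz => ?_
    · simp [Real.zero_rpow (by linarith : p ≠ 0)]
    · have hz : |z.re| ^ p + |z.im / b| ^ p < 1 := hz
      exact hz.le
  have key := le_inverseMarkovFactor_of_enclosing_disks hR (isCompact_lpEllipse hp1 hb) hinf
    (fun z hz => exists_enclosing_disk h hq hb (curvatureRadius_le h hq hb hb1) hz) n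
  convert key using 2
  have e1 : (2 : ℝ) ^ (1 / p - 3 / 2) * (2 * 2 ^ (1 / q - 1 / 2)) = 1 := by
    have : (2 : ℝ) * 2 ^ (1 / q - 1 / 2) = 2 ^ (1 + (1 / q - 1 / 2)) := by
      rw [Real.rpow_add two_pos, Real.rpow_one]
    rw [this, ← Real.rpow_add two_pos]
    have := h.inv_add_inv_eq_one
    rw [show 1 / p - 3 / 2 + (1 + (1 / q - 1 / 2)) = 0 by
      rw [one_div, one_div]; linarith, Real.rpow_zero]
  have h2 : (2 : ℝ) ^ (1 / q - 1 / 2) ≠ 0 := (Real.rpow_pos_of_pos two_pos _).ne'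
  rw [eq_div_iff (by positivity)]
  calc (p - 1) * b * 2 ^ (1 / p - 3 / 2) * (2 * ((q - 1) * 2 ^ (1 / q - 1 / 2) / b))
      = ((p - 1) * (q - 1)) * (2 ^ (1 / p - 3 / 2) * (2 * 2 ^ (1 / q - 1 / 2))) := by
        field_simp
    _ = 1 := by rw [hmul, e1, one_mul]

/-! ### The curvature at a boundary point -/

open Classical in
/-- The curvature of the boundary of the ellipse: infinite at the vertices, and elsewhere the
second derivative of the defining function along the unit tangent, over the norm of its
gradient. -/
noncomputable def lpCurvature (p b : ℝ) (z : ℂ) : EReal :=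
  if z.re = 0 ∨ z.im = 0 then ⊤
  else (((p - 1) * (|z.re| ^ (p - 2) * |z.im / b| ^ (p - 2)) /
    (b ^ 2 * ‖lpNormal p b z‖ ^ 3) : ℝ) : EReal)

/-- For `p < 2` the odd power has infinite slope at `0`. -/
lemma tendsto_oddPow_div_mul_atTop {p : ℝ} (hp2 : p < 2) {f : ℝ → ℝ} {f' c : ℝ}
    (hf : HasDerivAt f f' 0) (hf0 : f 0 = 0) (hc : 0 < f' * c) :
    Tendsto (fun t => oddPow p (f t) / t * c) (𝓝[≠] 0) atTop := by
  have hf'0 : f' ≠ 0 := left_ne_zero_of_mul hc.ne'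
  have h1 : Tendsto (fun t => |f t|) (𝓝[≠] 0) (𝓝[>] 0) := by
    refine tendsto_nhdsWithin_iff.2 ⟨?_, ?_⟩
    · have := hf.continuousAt.abs.tendsto
      rw [hf0, abs_zero] at this
      exact this.mono_left nhdsWithin_le_nhds
    · filter_upwards [hf.eventually_ne (c := 0) hf'0] with t ht using abs_pos.2 ht
  have h2 : Tendsto (fun t => |f t| ^ (p - 2)) (𝓝[≠] 0) atTop :=
    (tendsto_rpow_neg_nhdsGT_zero (by linarith : p - 2 < 0)).comp h1
  have h3 : Tendsto (fun t => f t / t * c) (𝓝[≠] 0) (𝓝 (f' * c)) := by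
    have := hf.tendsto_slope_zero
    simp only [zero_add, hf0, sub_zero, smul_eq_mul] at this
    refine (this.mul_const c).congr fun t => ?_
    ring
  refine (h2.atTop_mul_pos hc h3).congr fun t => ?_
  rw [oddPow]; ring

/-- The tangent direction of a counterclockwise regular curve in the boundary is the normal turned
by a right angle. -/
lemma tangent_angle {p b : ℝ} (hp : 1 < p) {γ : ℝ → ℂ} {d : ℂ} {t α : ℝ}
    (hγ : HasDerivAt γ d t) (hF : ∀ᶠ u in 𝓝 t, |(γ u).re| ^ p + |(γ u).im / b| ^ p = 1)
    (hd : d ≠ 0) (hα : d = (‖d‖ : ℂ) * Complex.exp ((α : ℂ) * Complex.I))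
    (hs : ∀ w ∈ lpEllipse p b, 0 ≤ ((starRingEnd ℂ) d * (w - γ t)).im) :
    ∃ l : ℝ, 0 < l ∧ d = (l : ℂ) * (Complex.I * lpNormal p b (γ t)) ∧
      ‖lpNormal p b (γ t)‖ * Real.cos α = -(lpNormal p b (γ t)).im ∧
      ‖lpNormal p b (γ t)‖ * Real.sin α = (lpNormal p b (γ t)).re := by
  have hdl := eq_smul_I_mul_lpNormal hp hF.self_of_nhds (lpNormal_inner_deriv_eq_zero hp hγ hF)
  set l := (γ t).re * d.im - (γ t).im * d.re with hl
  set g := lpNormal p b (γ t)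
  have hl0 : 0 ≤ l := by
    have := hs 0 (zero_mem_lpEllipse hp)
    simp only [zero_sub, Complex.mul_im, Complex.conj_re, Complex.conj_im, Complex.neg_re,
      Complex.neg_im] at this
    linarith
  have hlpos : 0 < l := lt_of_le_of_ne hl0 fun h => hd (by rw [hdl, ← h]; simp)
  refine ⟨l, hlpos, hdl, ?_⟩
  have hn : ‖d‖ = l * ‖g‖ := by
    rw [hdl, norm_mul, norm_mul, Complex.norm_I, one_mul, Complex.norm_real, Real.norm_eq_abs,
      abs_of_pos hlpos]
  have h1 : (l : ℂ) * (Complex.I * g) = l * (‖g‖ * Complex.exp ((α : ℂ) * Complex.I)) := by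
    rw [← hdl, ← mul_assoc, ← Complex.ofReal_mul, ← hn, ← hα]
  have h2 := mul_left_cancel₀ (Complex.ofReal_ne_zero.2 hlpos.ne') h1
  have hre := congrArg Complex.re h2
  have him := congrArg Complex.im h2
  rw [Complex.re_ofReal_mul, Complex.exp_ofReal_mul_I_re] at hre
  rw [Complex.im_ofReal_mul, Complex.exp_ofReal_mul_I_im] at him
  simp at hre him
  exact ⟨hre.symm, him.symm⟩

/-- The wedge product of the normals at the points `γ 0` and `γ t`, over `t`, converges; it
tends to `+∞` at the vertices. -/
lemma tendsto_wedge_lpNormal_div {p b : ℝ} (hp1 : 1 < p) (hp2 : p < 2) (hb : 0 < b) {γ : ℝ → ℂ}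
    {l : ℝ} (hl : 0 < l) (hz : |(γ 0).re| ^ p + |(γ 0).im / b| ^ p = 1)
    (hγ : HasDerivAt γ ((l : ℂ) * (Complex.I * lpNormal p b (γ 0))) 0) :
    (((γ 0).re = 0 ∨ (γ 0).im = 0) → Tendsto (fun t => ((lpNormal p b (γ t)).im *
        (lpNormal p b (γ 0)).re - (lpNormal p b (γ t)).re * (lpNormal p b (γ 0)).im) / t)
      (𝓝[≠] 0) atTop) ∧
    (¬((γ 0).re = 0 ∨ (γ 0).im = 0) → Tendsto (fun t => ((lpNormal p b (γ t)).im *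
        (lpNormal p b (γ 0)).re - (lpNormal p b (γ t)).re * (lpNormal p b (γ 0)).im) / t)
      (𝓝[≠] 0) (𝓝 ((p - 1) * l / b ^ 2 * (|(γ 0).re| ^ (p - 2) * |(γ 0).im / b| ^ (p - 2))))) := by
  have hg0 := lpNormal_ne_zero hp1 hz
  set g := lpNormal p b (γ 0) with hg
  have hre : HasDerivAt (fun u => (γ u).re) (-(l * g.im)) 0 := by
    have : HasDerivAt (fun u => (γ u).re) _ 0 := Complex.reCLM.hasFDerivAt.comp_hasDerivAt 0 hγ
    refine this.congr_deriv ?_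
    simp
  have him : HasDerivAt (fun u => (γ u).im / b) (l * g.re / b) 0 := by
    have : HasDerivAt (fun u => (γ u).im) _ 0 := Complex.imCLM.hasFDerivAt.comp_hasDerivAt 0 hγ
    refine (this.div_const b).congr_deriv ?_
    simp
  constructor
  · rintro (h0 | h0)
    · have hgre : g.re = 0 := by simp [hg, lpNormal, h0, oddPow_zero]
      have hgim : g.im ≠ 0 := fun h => hg0 (Complex.ext hgre h)
      have := tendsto_oddPow_div_mul_atTop hp2 hre h0 (c := -g.im) (by
        have : 0 < l * g.im ^ 2 := by positivity
        linarith)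
      refine this.congr fun t => ?_
      rw [hgre]
      simp only [lpNormal]
      ring
    · have hgim : g.im = 0 := by simp [hg, lpNormal, h0, oddPow_zero]
      have hgre : g.re ≠ 0 := fun h => hg0 (Complex.ext h hgim)
      have := tendsto_oddPow_div_mul_atTop hp2 him (by simp [h0]) (c := g.re / b) (by
        have : 0 < l * g.re ^ 2 / b ^ 2 := by positivity
        convert this using 1
        ring)
      refine this.congr fun t => ?_
      rw [hgim]
      simp only [lpNormal]
      ring
  · intro h0
    push Not at h0
    have h1 := (hasDerivAt_oddPow (p := p) (Or.inl h0.1)).comp 0 hre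
    have h2 := (hasDerivAt_oddPow (p := p) (Or.inl (div_ne_zero h0.2 hb.ne'))).comp 0 him
    have h3 := ((h2.div_const b).mul_const g.re).sub (h1.mul_const g.im)
    have h4 := h3.tendsto_slope_zero
    have e : (p - 1) * |(γ 0).im / b| ^ (p - 2) * (l * g.re / b) / b * g.re -
        (p - 1) * |(γ 0).re| ^ (p - 2) * -(l * g.im) * g.im =
        (p - 1) * l / b ^ 2 * (|(γ 0).re| ^ (p - 2) * |(γ 0).im / b| ^ (p - 2)) := by
      have e1 : g.re ^ 2 = _ := oddPow_sq hp1 (γ 0).re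
      have e2 : g.im ^ 2 = |(γ 0).im / b| ^ (p - 2) * |(γ 0).im / b| ^ p / b ^ 2 := by
        rw [← oddPow_sq hp1, hg, lpNormal]; ring
      linear_combination (p - 1) * l / b ^ 2 * |(γ 0).im / b| ^ (p - 2) * e1
        + (p - 1) * l * |(γ 0).re| ^ (p - 2) * e2
        + (p - 1) * l / b ^ 2 * (|(γ 0).re| ^ (p - 2) * |(γ 0).im / b| ^ (p - 2)) * hz
    rw [e] at h4
    refine h4.congr fun t => ?_
    simp only [Pi.sub_apply, Function.comp_apply, zero_add, smul_eq_mul, hg, lpNormal]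
    ring

/-- Along every admissible parametrization, the difference quotient of the tangent angle by the
arc length tends to `lpCurvature`. -/
lemma tendsto_angle_div_arcLength {p b r : ℝ} (hp1 : 1 < p) (hp2 : p < 2) (hb : 0 < b)
    {γ : ℝ → ℂ} {α : ℝ → ℝ} (hr : 0 < r) (hγ : ContDiffOn ℝ 1 γ (Ioo (-r) r))
    (hα : ContinuousOn α (Ioo (-r) r))
    (h : ∀ t ∈ Ioo (-r) r,
      γ t ∈ frontier (lpEllipse p b) ∧ deriv γ t ≠ 0 ∧
      deriv γ t = (‖deriv γ t‖ : ℂ) * Complex.exp ((α t : ℂ) * Complex.I) ∧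
      ∀ w ∈ lpEllipse p b, 0 ≤ ((starRingEnd ℂ) (deriv γ t) * (w - γ t)).im) :
    Tendsto (fun t : ℝ => (((α t - α 0) / ∫ u in (0 : ℝ)..t, ‖deriv γ u‖ : ℝ) : EReal))
      (𝓝[≠] 0) (𝓝 (lpCurvature p b (γ 0))) := by
  have h0 : (0 : ℝ) ∈ Ioo (-r) r := ⟨by linarith, hr⟩
  have hI : ∀ t ∈ Ioo (-r) r, Ioo (-r) r ∈ 𝓝 t := fun t ht => isOpen_Ioo.mem_nhds ht
  have hderiv : ∀ t ∈ Ioo (-r) r, HasDerivAt γ (deriv γ t) t := fun t ht =>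
    ((hγ.differentiableOn one_ne_zero).differentiableAt (hI t ht)).hasDerivAt
  have hF : ∀ t ∈ Ioo (-r) r, |(γ t).re| ^ p + |(γ t).im / b| ^ p = 1 := fun t ht =>
    (mem_frontier_lpEllipse hp1).1 (h t ht).1
  have hFe : ∀ t ∈ Ioo (-r) r, ∀ᶠ u in 𝓝 t, |(γ u).re| ^ p + |(γ u).im / b| ^ p = 1 :=
    fun t ht => Filter.mem_of_superset (hI t ht) hF
  have htan := fun t ht => tangent_angle hp1 (hderiv t ht) (hFe t ht) (h t ht).2.1
    (h t ht).2.2.1 (h t ht).2.2.2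
  obtain ⟨l, hl, hd0, hc0, hs0⟩ := htan 0 h0
  have hg0 : 0 < ‖lpNormal p b (γ 0)‖ := norm_pos_iff.2 (lpNormal_ne_zero hp1 (hF 0 h0))
  set g := lpNormal p b (γ 0) with hg
  have hspeed : ‖deriv γ 0‖ = l * ‖g‖ := by
    rw [hd0, norm_mul, norm_mul, Complex.norm_I, one_mul, Complex.norm_real, Real.norm_eq_abs,
      abs_of_pos hl]
  -- the arc length is asymptotic to the speed times `t`
  have harc : Tendsto (fun t => (∫ u in (0 : ℝ)..t, ‖deriv γ u‖) / t) (𝓝[≠] 0)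
      (𝓝 (l * ‖g‖)) := by
    have hcont : ContinuousAt (fun u => ‖deriv γ u‖) 0 :=
      ((hγ.continuousOn_deriv_of_isOpen isOpen_Ioo le_rfl).continuousAt (hI 0 h0)).norm
    have := intervalIntegral.integral_hasDerivAt_right (a := 0) (b := 0)
      (f := fun u => ‖deriv γ u‖) (by simp)
      ((measurable_deriv γ).norm.stronglyMeasurable.stronglyMeasurableAtFilter) hcont
    have := this.tendsto_slope_zero
    rw [hspeed] at this
    refine this.congr fun t => ?_
    simp only [zero_add, intervalIntegral.integral_same, sub_zero, smul_eq_mul]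
    ring
  have hden : Tendsto (fun t => ‖lpNormal p b (γ t)‖ * ‖g‖ * Real.sinc (α t - α 0) *
      ((∫ u in (0 : ℝ)..t, ‖deriv γ u‖) / t)) (𝓝[≠] 0) (𝓝 (l * ‖g‖ ^ 3)) := by
    have h1 : ContinuousAt (fun t => ‖lpNormal p b (γ t)‖ * ‖g‖ * Real.sinc (α t - α 0)) 0 := by
      have hα0 : ContinuousAt α 0 := hα.continuousAt (hI 0 h0)
      have hγ0 := (hderiv 0 h0).continuousAt
      exact (((continuous_lpNormal hp1).continuousAt.comp hγ0).norm.mul continuousAt_const).mul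
        (Real.continuous_sinc.continuousAt.comp (hα0.sub continuousAt_const))
    have h2 := (h1.tendsto.mono_left nhdsWithin_le_nhds).mul harc
    rw [sub_self, Real.sinc_zero] at h2
    convert h2 using 2
    ring
  -- the wedge product of the normals is `sin (α t - α 0)` times their lengths
  have hquot : ∀ᶠ t in 𝓝[≠] (0 : ℝ),
      ((lpNormal p b (γ t)).im * g.re - (lpNormal p b (γ t)).re * g.im) / t /
        (‖lpNormal p b (γ t)‖ * ‖g‖ * Real.sinc (α t - α 0) *
          ((∫ u in (0 : ℝ)..t, ‖deriv γ u‖) / t)) =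
      (α t - α 0) / ∫ u in (0 : ℝ)..t, ‖deriv γ u‖ := by
    filter_upwards [hden.eventually_ne (by positivity : l * ‖g‖ ^ 3 ≠ 0),
      mem_nhdsWithin_of_mem_nhds (hI 0 h0), self_mem_nhdsWithin] with t hne ht ht0
    have ht0 : t ≠ 0 := ht0
    obtain ⟨-, -, -, hct, hst⟩ := htan t ht
    have hW : (lpNormal p b (γ t)).im * g.re - (lpNormal p b (γ t)).re * g.im =
        ‖lpNormal p b (γ t)‖ * ‖g‖ * (Real.sinc (α t - α 0) * (α t - α 0)) := by
      have hsinc : Real.sinc (α t - α 0) * (α t - α 0) = Real.sin (α t - α 0) := by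
        rcases eq_or_ne (α t - α 0) 0 with hz | hz
        · rw [hz]; simp
        · rw [Real.sinc_of_ne_zero hz, div_mul_cancel₀ _ hz]
      rw [hsinc, Real.sin_sub, ← hs0, ← hst,
        show g.im = -(‖g‖ * Real.cos (α 0)) by rw [hc0, neg_neg],
        show (lpNormal p b (γ t)).im = -(‖lpNormal p b (γ t)‖ * Real.cos (α t)) by
          rw [hct, neg_neg]]
      ring
    have hS : (∫ u in (0 : ℝ)..t, ‖deriv γ u‖) ≠ 0 := by
      intro h; rw [h] at hne; simp at hne
    have hsinc0 := right_ne_zero_of_mul (left_ne_zero_of_mul hne)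
    have hN := left_ne_zero_of_mul (left_ne_zero_of_mul (left_ne_zero_of_mul hne))
    rw [hW]
    field_simp
  obtain ⟨hv, hnv⟩ := tendsto_wedge_lpNormal_div hp1 hp2 hb hl (hF 0 h0) (hd0 ▸ hderiv 0 h0)
  have hpos : 0 < l * ‖g‖ ^ 3 := by positivity
  unfold lpCurvature
  split_ifs with hvert
  · refine EReal.tendsto_coe_nhds_top_iff.2 (Tendsto.congr' hquot ?_)
    exact (hv hvert).atTop_mul_pos (inv_pos.2 hpos) (hden.inv₀ hpos.ne')
  · refine (continuous_coe_real_ereal.tendsto _).comp (Tendsto.congr' hquot ?_)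
    have := (hnv hvert).div hden hpos.ne'
    have heq : (p - 1) * (|(γ 0).re| ^ (p - 2) * |(γ 0).im / b| ^ (p - 2)) / (b ^ 2 * ‖g‖ ^ 3) =
        (p - 1) * l / b ^ 2 * (|(γ 0).re| ^ (p - 2) * |(γ 0).im / b| ^ (p - 2)) /
          (l * ‖g‖ ^ 3) := by
      field_simp
    rw [heq]
    exact this

lemma HasBoundaryCurvatureAt.eq_lpCurvature {p b : ℝ} (hp1 : 1 < p) (hp2 : p < 2) (hb : 0 < b)
    {z : ℂ} {κ : EReal} (h : HasBoundaryCurvatureAt (lpEllipse p b) z κ) :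
    κ = lpCurvature p b z := by
  obtain ⟨r, γ, α, hr, rfl, hγ, hα, hprop, hlim⟩ := h
  exact tendsto_nhds_unique hlim (tendsto_angle_div_arcLength hp1 hp2 hb hr hγ hα hprop)

/-- The parametrization of the boundary by the argument is admissible, so that the curvature
exists. -/
lemma hasBoundaryCurvatureAt_lpCurvature {p b : ℝ} (hp1 : 1 < p) (hp2 : p < 2) (hb : 0 < b)
    {z : ℂ} (hz : z ∈ frontier (lpEllipse p b)) :
    HasBoundaryCurvatureAt (lpEllipse p b) z (lpCurvature p b z) := by
  rw [mem_frontier_lpEllipse hp1] at hz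
  have hp0 : 0 < p := by linarith
  set θ := z.arg with hθ
  set N : ℝ → ℝ := fun t => polarSum p b⁻¹ (θ + t) with hN
  have hNpos : ∀ t, 0 < N t := fun t => polarSum_pos (inv_pos.2 hb) _
  set ρ : ℝ → ℝ := fun t => N t ^ (-(1 / p)) with hρ
  have hρpos : ∀ t, 0 < ρ t := fun t => Real.rpow_pos_of_pos (hNpos t) _
  have hNC : ContDiff ℝ 1 N := by
    have h1 : ContDiff ℝ 1 (fun t : ℝ => Real.cos (θ + t)) := by fun_prop
    have h2 : ContDiff ℝ 1 (fun t : ℝ => b⁻¹ * Real.sin (θ + t)) := by fun_prop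
    exact ((contDiff_abs_rpow hp1).comp h1).add ((contDiff_abs_rpow hp1).comp h2)
  have hρC : ContDiff ℝ 1 ρ := hNC.rpow_const_of_ne fun t => (hNpos t).ne'
  have hρd : ∀ t, HasDerivAt ρ (deriv ρ t) t := fun t =>
    (hρC.differentiable one_ne_zero t).hasDerivAt
  have hρ' : Continuous (deriv ρ) := hρC.continuous_deriv le_rfl
  set E : ℝ → ℂ := fun t => Complex.exp (((θ + t : ℝ) : ℂ) * Complex.I) with hE
  have hEC : ContDiff ℝ 1 E := by
    have : ContDiff ℝ 1 (fun t : ℝ => ((θ + t : ℝ) : ℂ) * Complex.I) :=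
      (Complex.ofRealCLM.contDiff.comp (contDiff_const.add contDiff_id)).mul contDiff_const
    exact this.cexp
  have hEd : ∀ t, HasDerivAt E (E t * Complex.I) t := by
    intro t
    have h1 : HasDerivAt (fun t : ℝ => ((θ + t : ℝ) : ℂ) * Complex.I) Complex.I t := by
      simpa using (((hasDerivAt_id t).const_add θ).ofReal_comp).mul_const Complex.I
    exact h1.cexp
  have hEre : ∀ t, (E t).re = Real.cos (θ + t) := fun t => Complex.exp_ofReal_mul_I_re _
  have hEim : ∀ t, (E t).im = Real.sin (θ + t) := fun t => Complex.exp_ofReal_mul_I_im _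
  set γ : ℝ → ℂ := fun t => (ρ t : ℂ) * E t with hγ
  -- the velocity in the rotating frame
  set v : ℝ → ℂ := fun t => ((deriv ρ t : ℝ) : ℂ) + ρ t * Complex.I with hv
  have hvim : ∀ t, (v t).im = ρ t := fun t => by simp [hv]
  have hγd : ∀ t, HasDerivAt γ (v t * E t) t := by
    intro t
    refine ((hρd t).ofReal_comp.mul (hEd t)).congr_deriv ?_
    simp only [hv]; ring
  have hγderiv : ∀ t, deriv γ t = v t * E t := fun t => (hγd t).deriv
  have hγre : ∀ t, (γ t).re = ρ t * Real.cos (θ + t) := fun t => by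
    rw [hγ, Complex.re_ofReal_mul, hEre]
  have hγim : ∀ t, (γ t).im = ρ t * Real.sin (θ + t) := fun t => by
    rw [hγ, Complex.im_ofReal_mul, hEim]
  have scale : ∀ s t : ℝ, 0 < s → |s * Real.cos (θ + t)| ^ p + |s * Real.sin (θ + t) / b| ^ p
      = s ^ p * N t := by
    intro s t hs
    rw [mul_div_assoc, div_eq_inv_mul, abs_mul, abs_mul, Real.mul_rpow (abs_nonneg _) (abs_nonneg _),
      Real.mul_rpow (abs_nonneg _) (abs_nonneg _), abs_of_pos hs, ← mul_add]
    rfl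
  have hF : ∀ t, |(γ t).re| ^ p + |(γ t).im / b| ^ p = 1 := by
    intro t
    rw [hγre, hγim, scale _ _ (hρpos t), hρ, ← Real.rpow_mul (hNpos t).le,
      show -(1 / p) * p = -1 by field_simp, Real.rpow_neg_one, inv_mul_cancel₀ (hNpos t).ne']
  have hz0 : 0 < ‖z‖ := by
    rw [norm_pos_iff]
    rintro rfl
    simp [Real.zero_rpow hp0.ne'] at hz
  have hγ0 : γ 0 = z := by
    have h1 := scale ‖z‖ 0 hz0
    rw [add_zero, hθ, Complex.norm_mul_cos_arg, Complex.norm_mul_sin_arg, hz] at h1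
    have h2 : ρ 0 = ‖z‖ := by
      have : N 0 = ‖z‖ ^ (-p) := by
        rw [Real.rpow_neg hz0.le]
        exact eq_inv_of_mul_eq_one_right h1.symm
      rw [hρ]
      simp only
      rw [this, ← Real.rpow_mul hz0.le, show -p * -(1 / p) = 1 by field_simp, Real.rpow_one]
    rw [hγ]
    simp only [h2, hE, add_zero]
    exact Complex.norm_mul_exp_arg_mul_I z
  have hγC : ContDiff ℝ 1 γ := (Complex.ofRealCLM.contDiff.comp hρC).mul hEC
  set α : ℝ → ℝ := fun t => θ + t + (v t).arg with hα
  have hαC : Continuous α := by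
    have hvC : Continuous v := (Complex.continuous_ofReal.comp hρ').add
      ((Complex.continuous_ofReal.comp hρC.continuous).mul continuous_const)
    refine (continuous_const.add continuous_id).add (continuous_iff_continuousAt.2 fun t => ?_)
    refine (Complex.continuousAt_arg ?_).comp hvC.continuousAt
    exact Complex.mem_slitPlane_iff.2 (Or.inr (by rw [hvim]; exact (hρpos t).ne'))
  have hprop : ∀ t ∈ Ioo (-1 : ℝ) 1, γ t ∈ frontier (lpEllipse p b) ∧ deriv γ t ≠ 0 ∧
      deriv γ t = (‖deriv γ t‖ : ℂ) * Complex.exp ((α t : ℂ) * Complex.I) ∧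
      ∀ w ∈ lpEllipse p b, 0 ≤ ((starRingEnd ℂ) (deriv γ t) * (w - γ t)).im := by
    intro t _
    refine ⟨(mem_frontier_lpEllipse hp1).2 (hF t), ?_, ?_, fun w hw => ?_⟩
    · rw [hγderiv]
      refine mul_ne_zero (fun h => ?_) (Complex.exp_ne_zero _)
      have := hvim t
      rw [h, Complex.zero_im] at this
      exact (hρpos t).ne this
    · have hEn : ‖E t‖ = 1 := Complex.norm_exp_ofReal_mul_I _
      have hexp : Complex.exp ((α t : ℂ) * Complex.I) =
          E t * Complex.exp ((v t).arg * Complex.I) := by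
        simp only [hα, hE]
        rw [← Complex.exp_add, ← add_mul, ← Complex.ofReal_add]
      rw [hγderiv, norm_mul, hEn, mul_one, hexp, mul_left_comm, Complex.norm_mul_exp_arg_mul_I,
        mul_comm]
    · have hl := eq_smul_I_mul_lpNormal hp1 (hF t) (lpNormal_inner_deriv_eq_zero hp1 (hγd t)
        (Eventually.of_forall hF))
      have hl2 : (γ t).re * (v t * E t).im - (γ t).im * (v t * E t).re = ρ t ^ 2 := by
        rw [hγre, hγim, Complex.mul_re, Complex.mul_im, hEre, hEim, hvim]
        linear_combination ρ t ^ 2 * Real.sin_sq_add_cos_sq (θ + t)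
      rw [hl2] at hl
      rw [hγderiv, hl]
      have h1 := lpNormal_inner_le hp1 (hF t) hw
      have h2 := lpNormal_inner_self (b := b) hp1 (γ t)
      rw [hF t] at h2
      have h3 : ((starRingEnd ℂ) (((ρ t ^ 2 : ℝ) : ℂ) * (Complex.I * lpNormal p b (γ t))) *
          (w - γ t)).im = ρ t ^ 2 * (((lpNormal p b (γ t)).re * (γ t).re +
            (lpNormal p b (γ t)).im * (γ t).im) - ((lpNormal p b (γ t)).re * w.re +
            (lpNormal p b (γ t)).im * w.im)) := by
        rw [map_mul, Complex.conj_ofReal, mul_assoc, Complex.im_ofReal_mul]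
        congr 1
        simp
        ring
      rw [h3, h2]
      exact mul_nonneg (sq_nonneg _) (by linarith)
  refine ⟨1, γ, α, one_pos, hγ0, hγC.contDiffOn, hαC.continuousOn, hprop, ?_⟩
  rw [← hγ0]
  exact tendsto_angle_div_arcLength hp1 hp2 hb one_pos hγC.contDiffOn hαC.continuousOn hprop

lemma lpCurvature_eq_top_iff {p b : ℝ} {z : ℂ} :
    lpCurvature p b z = ⊤ ↔ z.re = 0 ∨ z.im = 0 := by
  unfold lpCurvature
  split_ifs with h
  · simp [h]
  · simp only [h, iff_false]
    exact EReal.coe_ne_top _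

lemma le_lpCurvature {p b : ℝ} (hp1 : 1 < p) (hp2 : p < 2) (hb : 0 < b) (hb1 : b ≤ 1)
    {z : ℂ} (hz : z ∈ frontier (lpEllipse p b)) :
    (((p - 1) * b * 2 ^ (1 / p - 1 / 2) : ℝ) : EReal) ≤ lpCurvature p b z := by
  rw [mem_frontier_lpEllipse hp1] at hz
  unfold lpCurvature
  split_ifs with hv
  · exact le_top
  push Not at hv
  rw [EReal.coe_le_coe_iff]
  have hx := abs_pos.2 hv.1
  have hy := abs_pos.2 (div_ne_zero hv.2 hb.ne')
  have hg : 0 < ‖lpNormal p b z‖ := norm_pos_iff.2 (lpNormal_ne_zero hp1 hz)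
  have h := Real.HolderConjugate.conjExponent hp1
  set q := p.conjExponent
  have hmul : (p - 1) * (q - 1) = 1 := by linarith [h.mul_eq_add]
  have hq : 2 < q := by nlinarith
  have key := mul_rpow_mul_sq_add_sq_rpow_le hq (a := |z.re| ^ (p - 1))
    (c := |z.im / b| ^ (p - 1)) (by positivity) (by positivity)
  rw [← Real.rpow_mul hx.le, ← Real.rpow_mul hy.le, h.sub_one_mul_conj, hz, Real.one_rpow, mul_one,
    ← Real.mul_rpow hx.le hy.le, ← Real.rpow_mul (by positivity),
    show (p - 1) * (q - 2) = -(p - 2) by linarith, Real.rpow_neg (by positivity),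
    Real.mul_rpow hx.le hy.le] at key
  have h1 : (b * ‖lpNormal p b z‖) ^ 3 ≤
      ((|z.re| ^ (p - 1)) ^ 2 + (|z.im / b| ^ (p - 1)) ^ 2) ^ (3 / 2 : ℝ) := by
    have : (b * ‖lpNormal p b z‖) ^ 3 = ((b * ‖lpNormal p b z‖) ^ 2) ^ (3 / 2 : ℝ) := by
      rw [← Real.rpow_natCast _ 2, ← Real.rpow_mul (by positivity), ← Real.rpow_natCast]; norm_num
    rw [this]
    refine Real.rpow_le_rpow (by positivity) ?_ (by norm_num)
    rw [← abs_oddPow hp1, ← abs_oddPow hp1, sq_abs, sq_abs, mul_pow, ← Complex.normSq_eq_norm_sq,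
      Complex.normSq_apply, lpNormal]
    simp only
    have e : b ^ 2 * (oddPow p z.re * oddPow p z.re +
        oddPow p (z.im / b) / b * (oddPow p (z.im / b) / b)) =
        b ^ 2 * oddPow p z.re ^ 2 + oddPow p (z.im / b) ^ 2 := by
      field_simp
    rw [e]
    have hb2 : b ^ 2 ≤ 1 := pow_le_one₀ hb.le hb1
    nlinarith [mul_nonneg (sub_nonneg.2 hb2) (sq_nonneg (oddPow p z.re))]
  set X := |z.re| ^ (p - 2) * |z.im / b| ^ (p - 2)
  have hX : 0 < X := by positivity
  have h2 : (b * ‖lpNormal p b z‖) ^ 3 ≤ X * 2 ^ (1 / q - 1 / 2) := by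
    rw [← div_le_iff₀' hX, div_eq_inv_mul]
    exact (mul_le_mul_of_nonneg_left h1 (by positivity)).trans key
  have e1 : (2 : ℝ) ^ (1 / q - 1 / 2) * 2 ^ (1 / p - 1 / 2) = 1 := by
    rw [← Real.rpow_add two_pos]
    have := h.inv_add_inv_eq_one
    rw [show 1 / q - 1 / 2 + (1 / p - 1 / 2) = 0 by
      simp only [one_div]; linarith, Real.rpow_zero]
  rw [le_div_iff₀ (by positivity)]
  calc (p - 1) * b * 2 ^ (1 / p - 1 / 2) * (b ^ 2 * ‖lpNormal p b z‖ ^ 3)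
      = (p - 1) * 2 ^ (1 / p - 1 / 2) * (b * ‖lpNormal p b z‖) ^ 3 := by ring
    _ ≤ (p - 1) * 2 ^ (1 / p - 1 / 2) * (X * 2 ^ (1 / q - 1 / 2)) := by
        have : 0 < p - 1 := by linarith
        gcongr
    _ = (p - 1) * X := by linear_combination (p - 1) * X * e1

/-- On the diagonal the curvature bound is attained. -/
lemma exists_lpCurvature_eq {p : ℝ} (hp1 : 1 < p) :
    ∃ z ∈ frontier (lpEllipse p 1),
      lpCurvature p 1 z = (((p - 1) * 2 ^ (1 / p - 1 / 2) : ℝ) : EReal) := by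
  have hp0 : 0 < p := by linarith
  set m : ℝ := 2 ^ (-(1 / p)) with hm
  have hm0 : 0 < m := Real.rpow_pos_of_pos two_pos _
  refine ⟨⟨m, m⟩, ?_, ?_⟩
  · rw [mem_frontier_lpEllipse hp1]
    simp only [div_one]
    rw [abs_of_pos hm0, hm, ← Real.rpow_mul two_pos.le, show -(1 / p) * p = -1 by field_simp,
      Real.rpow_neg_one]
    norm_num
  · unfold lpCurvature
    simp only [hm0.ne', or_self, if_false, div_one, abs_of_pos hm0, one_pow, one_mul]
    have hn : ‖lpNormal p 1 ⟨m, m⟩‖ = m ^ (p - 1) * 2 ^ (1 / 2 : ℝ) := by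
      have e : oddPow p m = m ^ (p - 1) := by
        have h := abs_oddPow hp1 m
        rwa [abs_of_pos hm0, abs_of_pos (by rw [oddPow]; positivity)] at h
      rw [← Real.sqrt_eq_rpow, Complex.norm_def, Complex.normSq_apply, lpNormal]
      simp only [div_one, e]
      rw [← two_mul, mul_comm, Real.sqrt_mul (by positivity), Real.sqrt_mul_self (by positivity)]
    rw [hn, mul_pow, ← Real.rpow_natCast (m ^ (p - 1)), ← Real.rpow_natCast (2 ^ (1 / 2 : ℝ)), hm]
    simp only [← Real.rpow_mul two_pos.le, mul_div_assoc, ← Real.rpow_add two_pos,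
      ← Real.rpow_sub two_pos]
    congr 3
    push_cast
    field_simp
    ring

/-! ### The curvature and Markov factor bounds -/

theorem mainTheorem5 (p : ℝ) (hp1 : 1 < p) (hp2 : p < 2) :
    (∀ b : ℝ, 0 < b → b ≤ 1 →
      (∀ z ∈ frontier (lpEllipse p b),
        (∃ κ : EReal, HasBoundaryCurvatureAt (lpEllipse p b) z κ) ∧
        ∀ κ : EReal, HasBoundaryCurvatureAt (lpEllipse p b) z κ →
          (((p - 1) * b * 2 ^ (1 / p - 1 / 2) : ℝ) : EReal) ≤ κ ∧
          (κ = ⊤ ↔ z.re = 0 ∨ z.im = 0)) ∧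
      ∀ n : ℕ,
        (p - 1) * b * 2 ^ (1 / p - 3 / 2) * (n : ℝ) ≤ inverseMarkovFactor n (lpEllipse p b)) ∧
    IsLeast {κ : EReal | ∃ z ∈ frontier (lpEllipse p 1),
        HasBoundaryCurvatureAt (lpEllipse p 1) z κ}
      (((p - 1) * 2 ^ (1 / p - 1 / 2) : ℝ) : EReal) := by
  refine ⟨fun b hb hb1 => ⟨fun z hz => ⟨⟨_, hasBoundaryCurvatureAt_lpCurvature hp1 hp2 hb hz⟩,
    fun κ hκ => ?_⟩, le_inverseMarkovFactor_lpEllipse hp1 hp2 hb hb1⟩, ?_, ?_⟩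
  · rw [hκ.eq_lpCurvature hp1 hp2 hb]
    exact ⟨le_lpCurvature hp1 hp2 hb hb1 hz, lpCurvature_eq_top_iff⟩
  · obtain ⟨z, hz, he⟩ := exists_lpCurvature_eq hp1
    exact ⟨z, hz, he ▸ hasBoundaryCurvatureAt_lpCurvature hp1 hp2 one_pos hz⟩
  · rintro κ ⟨z, hz, hκ⟩
    rw [hκ.eq_lpCurvature hp1 hp2 one_pos]
    simpa using le_lpCurvature hp1 hp2 one_pos le_rfl hz
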